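/- Let $k$ be a field and $A$ a finite-dimensional $k$-algebra. Let $A\text{-mod}$ be the category of finite-dimensional left $A$-modules and $A\text{-proj}$ its full subcategory of finitely generated projective modules; let $K^b(A\text{-proj})$ be the homotopy category of bounded complexes of objects of $A\text{-proj}$, and $D^b(A\text{-mod})$ the bounded derived category of $A\text{-mod}$. A complex $X=(X^i,d^i)$ over $A\text{-proj}$ is homotopy minimal if $\operatorname{Im} d^i\subseteq \operatorname{rad} X^{i+1}$ for all $i\in\mathbb{Z}$. For an integer $m\ge 0$, let $C_m(A\text{-proj})$ be the category of homotopy minimal complexes $X$ over $A\text{-proj}$ with $X^i=0$ for $i\notin\{0,1,\dots,m\}$, with all morphisms of complexes as morphisms. It is of finite representation type if it has only finitely many indecomposable objects up to isomorphism. The category $K^b(A\text{-proj})$ is discrete (respectively, the algebra $A$ is derived-discrete) if for every finitely supported vector $(n_i)_{i\in\mathbb{Z}}$ of natural numbers there are, up to isomorphism, only finitely many objects $X$ of $K^b(A\text{-proj})$ (respectively of $D^b(A\text{-mod})$) with $\dim_k H^i(X)=n_i$ for all $i\in\mathbb{Z}$. Then: 1. If $C_m(A\text{-proj})$ is of finite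 representation type for every integer $m>0$, then $K^b(A\text{-proj})$ is discrete. 2. $K^b(A\text{-proj})$ is discrete if and only if $A$ is derived-discrete. -/

import Mathlib

open CategoryTheory CategoryTheory.Limits

universe u v

noncomputable section

namespace DerivedRep

/-! ### Finiteness up to isomorphism, indecomposable objects -/

/-- Up to isomorphism, there are only finitely many objects satisfying `P`. -/
def FiniteUpToIso {C : Type*} [Category* C] (P : ObjectProperty C) : Prop :=
  ∃ S : Set C, S.Finite ∧ ∀ X : C, P X → ∃ Y ∈ S, Nonempty (X ≅ Y)

/-- A nonzero object is indecomposable if, whenever it is isomorphic to a biproduct of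
two objects, one of these two is zero. (Mathlib's `CategoryTheory.Indecomposable`, without the
assumption that all binary biproducts have been shown to exist.) -/
def IsIndecomposable {C : Type*} [Category* C] [HasZeroMorphisms C] : ObjectProperty C :=
  fun X ↦ ¬ IsZero X ∧ ∀ (Y Z : C) (b : BinaryBicone Y Z),
    Nonempty b.IsBilimit → Nonempty (X ≅ b.pt) → IsZero Y ∨ IsZero Z

/-- Up to isomorphism, there are only finitely many indecomposable objects. -/
def IsOfFiniteRepresentationType (C : Type*) [Category* C] [HasZeroMorphisms C] : Prop :=
  FiniteUpToIso (IsIndecomposable (C := C))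

/-! ### Modules and complexes

`FGModuleCat.{v} A` is the category of finitely generated left `A`-modules. When `A` is a
finite-dimensional `k`-algebra, these are exactly the finite-dimensional left `A`-modules. -/

section Ring

variable (A : Type v) [Ring A]

/-- The category of finitely generated projective left `A`-modules, as a full subcategory of
the category of finitely generated left `A`-modules. -/
def isProj : ObjectProperty (FGModuleCat.{v} A) :=
  fun M ↦ Module.Projective A M

/-- The category of finitely generated projective left `A`-modules. -/
abbrev Proj : Type (v + 1) := (isProj A).FullSubcategory

/-- The inclusion of finitely generated projective modules into finitely generated modules. -/
abbrev projInclusion : Proj A ⥤ FGModuleCat.{v} A := (isProj A).ι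

/-- The complexes `X` of finitely generated projective modules such that `X i = 0` for almost
all degrees `i`. -/
def isBoundedComplex : ObjectProperty (CochainComplex (Proj A) ℤ) :=
  fun X ↦ ∃ a b : ℤ, X.IsStrictlyGE a ∧ X.IsStrictlyLE b

variable {A} in
/-- A complex of finitely generated projective modules is homotopy minimal if the image of
each differential lies in the radical (the intersection of the maximal submodules)
of its target. -/
def IsHomotopyMinimal (X : CochainComplex (Proj A) ℤ) : Prop :=
  ∀ i : ℤ, LinearMap.range ((projInclusion A).map (X.d i (i + 1))).hom.hom ≤
    Module.jacobson A (X.X (i + 1)).obj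

/-- The homotopy minimal complexes of finitely generated projective modules which are
concentrated in the degrees `0, …, m`. -/
def isMinimalComplex (m : ℕ) : ObjectProperty (CochainComplex (Proj A) ℤ) :=
  fun X ↦ IsHomotopyMinimal X ∧ X.IsStrictlyGE 0 ∧ X.IsStrictlyLE (m : ℤ)

/-- The category `C_m(A-proj)` (morphisms are the morphisms of complexes). -/
abbrev MinimalComplexes (m : ℕ) : Type (v + 1) := (isMinimalComplex A m).FullSubcategory

/-- The homotopy category `K^b(A-proj)` of bounded complexes of finitely generated projective
modules. -/
abbrev Kb : Type (v + 1) :=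
  ((isBoundedComplex A).strictMap
    (HomotopyCategory.quotient (Proj A) (ComplexShape.up ℤ))).FullSubcategory

/-- The `i`-th cohomology `H^i : K^b(A-proj) ⥤ A-mod`. -/
def Kb.cohomology [IsNoetherianRing A] (i : ℤ) : Kb A ⥤ FGModuleCat.{v} A :=
  ObjectProperty.ι _ ⋙ (projInclusion A).mapHomotopyCategory (ComplexShape.up ℤ) ⋙
    HomotopyCategory.homologyFunctor (FGModuleCat.{v} A) (ComplexShape.up ℤ) i

/-- The bounded derived category `D^b(A-mod)`. -/
abbrev Db [IsNoetherianRing A] : Type (v + 1) :=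
  letI := HasDerivedCategory.standard (FGModuleCat.{v} A)
  DerivedCategory.Bounded (FGModuleCat.{v} A)

/-- The `i`-th cohomology `H^i : D^b(A-mod) ⥤ A-mod`. -/
def Db.cohomology [IsNoetherianRing A] (i : ℤ) : Db A ⥤ FGModuleCat.{v} A :=
  letI := HasDerivedCategory.standard (FGModuleCat.{v} A)
  DerivedCategory.Bounded.ι ⋙ DerivedCategory.homologyFunctor (FGModuleCat.{v} A) i

end Ring

/-! ### Discreteness -/

section Algebra

variable (k : Type u) [Field k] (A : Type v) [Ring A] [Algebra k A]

variable {A} in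
/-- The dimension over `k` of a finitely generated `A`-module, on which `k` acts through `A`. -/
def dim (M : FGModuleCat.{v} A) : ℕ :=
  Module.finrank k ((ModuleCat.restrictScalars (algebraMap k A)).obj M.obj)

variable [FiniteDimensional k A]

/-- `K^b(A-proj)` is discrete: for each cohomology dimension vector `n`, there are up to
isomorphism only finitely many objects `X` of `K^b(A-proj)` with `dim_k H^i(X) = n i`
for all `i`. -/
def IsKbDiscrete : Prop :=
  haveI : IsNoetherianRing A := IsNoetherianRing.of_finite k A
  ∀ n : ℤ →₀ ℕ, FiniteUpToIso fun X : Kb A ↦ ∀ i, dim k ((Kb.cohomology A i).obj X) = n i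

/-- `A` is derived-discrete: for each cohomology dimension vector `n`, there are up to
isomorphism only finitely many objects `X` of `D^b(A-mod)` with `dim_k H^i(X) = n i`
for all `i`. -/
def IsDerivedDiscrete : Prop :=
  haveI : IsNoetherianRing A := IsNoetherianRing.of_finite k A
  ∀ n : ℤ →₀ ℕ, FiniteUpToIso fun X : Db A ↦ ∀ i, dim k ((Db.cohomology A i).obj X) = n i

end Algebra

end DerivedRep

end

universe w

set_option linter.unusedSectionVars false

noncomputable section

/-! Everything passes through the condition `FiniteBoundedPerfect`, which concerns complexes of
projectives of bounded width and bounded term dimensions.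

It implies derived-discreteness. Let M have cohomology in degrees [a, b], of bounded dimension.
Killing the top cohomology by projectives, one degree at a time, gives a triangle M → X → K → M[1]
with K perfect of uniformly bounded size and X concentrated so far to the left that M[1] is the
truncation of K to degrees ≥ a - 1 (`exists_perfect_truncGE`). So K determines M.

Derived-discreteness passes to K^b(A-proj), which embeds fully faithfully in the derived category
compatibly with cohomology. Discreteness of K^b(A-proj) gives back `FiniteBoundedPerfect`, since
bounded terms leave only finitely many cohomology dimension vectors. This cycle proves the
equivalence.

For the first claim, `FiniteBoundedPerfect` is deduced from finite representation type. A bounded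
perfect complex can be made homotopy minimal without growing (`exists_radical_perfect`): if it is
not minimal, Fitting's lemma for a non-nilpotent null-homotopic endomorphism splits off a nonzero
summand that vanishes in the derived category. Finitely many indecomposables then leave finitely
many minimal complexes of bounded total dimension. -/

namespace DerivedRep

/-! ### Finitely generated modules: morphisms and projectivity -/

section FGModuleCat

variable {A : Type v} [Ring A]

instance : (forget₂ (FGModuleCat.{v} A) (ModuleCat.{v} A)).Additive where

variable [IsNoetherianRing A] {M N : FGModuleCat.{v} A}

lemma injective_of_mono (f : M ⟶ N) [Mono f] : Function.Injective f.hom.hom :=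
  (ModuleCat.mono_iff_injective ((forget₂ (FGModuleCat.{v} A) (ModuleCat.{v} A)).map f)).1
    inferInstance

lemma surjective_of_epi (f : M ⟶ N) [Epi f] : Function.Surjective f.hom.hom :=
  (ModuleCat.epi_iff_surjective ((forget₂ (FGModuleCat.{v} A) (ModuleCat.{v} A)).map f)).1
    inferInstance

lemma epi_of_surjective (f : M ⟶ N) (hf : Function.Surjective f.hom.hom) : Epi f :=
  (forget₂ (FGModuleCat.{v} A) (ModuleCat.{v} A)).epi_of_epi_map
    ((ModuleCat.epi_iff_surjective _).2 hf)

lemma isIso_of_bijective (f : M ⟶ N) (hf : Function.Bijective f.hom.hom) : IsIso f :=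
  ⟨(LinearEquiv.ofBijective f.hom.hom hf).toFGModuleCatIso.inv,
    (LinearEquiv.ofBijective f.hom.hom hf).toFGModuleCatIso.hom_inv_id,
    (LinearEquiv.ofBijective f.hom.hom hf).toFGModuleCatIso.inv_hom_id⟩

lemma subsingleton_of_isZero (h : IsZero M) : Subsingleton M := by
  have h := congr(($((IsZero.iff_id_eq_zero M).1 h)).hom.hom)
  exact ⟨fun x y ↦ congr($h x).trans congr($h y).symm⟩

lemma projective_of_moduleProjective (P : FGModuleCat.{v} A) [Module.Projective A P] :
    Projective P where
  factors {E X} f e _ := by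
    obtain ⟨g, hg⟩ := Module.projective_lifting_property e.hom.hom f.hom.hom (surjective_of_epi e)
    exact ⟨ConcreteCategory.ofHom (C := FGModuleCat A) g, by ext x; exact congr($hg x)⟩

lemma exists_free_epi (M : FGModuleCat.{v} A) {ι : Type} [Finite ι] (x : ι → M)
    (hx : Submodule.span A (Set.range x) = ⊤) :
    ∃ f : FGModuleCat.of A (ι → A) ⟶ M, Epi f := by
  have := Fintype.ofFinite ι
  refine ⟨ConcreteCategory.ofHom (C := FGModuleCat A) (Fintype.linearCombination A x),
    epi_of_surjective _ ?_⟩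
  change Function.Surjective (Fintype.linearCombination A x)
  rw [← LinearMap.range_eq_top, Fintype.range_linearCombination, hx]

lemma moduleProjective_of_projective (P : FGModuleCat.{v} A) [Projective P] :
    Module.Projective A P := by
  obtain ⟨n, x, hx⟩ := Module.Finite.exists_fin (R := A) (M := P)
  obtain ⟨f, _⟩ := exists_free_epi P x hx
  exact Module.Projective.of_split (Projective.factorThru (𝟙 P) f).hom.hom f.hom.hom
    (by
      rw [← FGModuleCat.hom_hom_comp, Projective.factorThru_comp]
      rfl)

end FGModuleCat

/-! ### Dimension over the base field -/

section Dim

variable (k : Type u) [Field k] {A : Type v} [Ring A] [Algebra k A]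

lemma dim_eq_finrank (M : FGModuleCat.{v} A) [Module k M] [IsScalarTower k A M] :
    dim k M = Module.finrank k M := by
  refine LinearEquiv.finrank_eq (M := (ModuleCat.restrictScalars (algebraMap k A)).obj M.obj)
    (N := M) ({ AddEquiv.refl M with map_smul' := fun a m ↦ ?_ })
  exact algebraMap_smul A a (M := M) m

/-- The `k`-vector space underlying a finitely generated `A`-module. -/
abbrev restrict (M : FGModuleCat.{v} A) : ModuleCat.{v} k :=
  (ModuleCat.restrictScalars (algebraMap k A)).obj M.obj

/-- The `k`-linear map underlying a morphism of finitely generated `A`-modules. -/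
abbrev restrictMap {M N : FGModuleCat.{v} A} (f : M ⟶ N) : restrict k M →ₗ[k] restrict k N :=
  ((ModuleCat.restrictScalars (algebraMap k A)).map f.hom).hom

variable {k}

lemma dim_eq_of_iso {M N : FGModuleCat.{v} A} (e : M ≅ N) : dim k M = dim k N :=
  ((ModuleCat.restrictScalars (algebraMap k A)).mapIso
    ((forget₂ (FGModuleCat.{v} A) (ModuleCat.{v} A)).mapIso e)).toLinearEquiv.finrank_eq

variable [FiniteDimensional k A]

instance finite_restrict (M : FGModuleCat.{v} A) : Module.Finite k (restrict k M) := by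
  let : Module k M.obj := Module.compHom _ (algebraMap k A)
  have : IsScalarTower k A M.obj := ⟨fun a b m ↦ by
    rw [Algebra.smul_def, mul_smul]; rfl⟩
  exact Module.Finite.trans (R := k) A M.obj

variable [IsNoetherianRing A]

lemma dim_le_of_mono {M N : FGModuleCat.{v} A} (f : M ⟶ N) [Mono f] : dim k M ≤ dim k N := by
  have := finite_restrict (k := k) N
  exact LinearMap.finrank_le_finrank_of_injective (f := restrictMap k f)
    (injective_of_mono f)

lemma dim_le_of_epi {M N : FGModuleCat.{v} A} (f : M ⟶ N) [Epi f] : dim k N ≤ dim k M := by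
  have := finite_restrict (k := k) M
  exact LinearMap.finrank_le_finrank_of_surjective (f := restrictMap k f)
    (surjective_of_epi f)

lemma dim_lt_of_mono {M N : FGModuleCat.{v} A} (f : M ⟶ N) [Mono f] (hf : ¬ Epi f) :
    dim k M < dim k N := by
  have := finite_restrict (k := k) N
  let g := restrictMap k f
  have hg : Function.Injective g := injective_of_mono f
  refine lt_of_eq_of_lt (LinearMap.finrank_range_of_inj hg).symm (Submodule.finrank_lt ?_)
  exact fun h ↦ hf (epi_of_surjective f (LinearMap.range_eq_top (f := g).1 h))

lemma dim_eq_zero_iff {M : FGModuleCat.{v} A} : dim k M = 0 ↔ IsZero M := by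
  have := finite_restrict (k := k) M
  constructor
  · intro h
    have : Subsingleton (restrict k M) := Module.finrank_zero_iff.1 h
    rw [IsZero.iff_id_eq_zero]
    ext x
    exact this.elim _ _
  · intro h
    exact Module.finrank_zero_iff.2 (subsingleton_of_isZero h)

lemma dim_le_add_of_exact {S : ShortComplex (FGModuleCat.{v} A)} (hS : S.Exact) :
    dim k S.X₂ ≤ dim k S.X₁ + dim k S.X₃ := by
  have h₁ := finite_restrict (k := k) S.X₁
  have h₂ := finite_restrict (k := k) S.X₂
  have h₃ := finite_restrict (k := k) S.X₃
  have h := (ShortComplex.ShortExact.moduleCat_exact_iff_function_exact _).1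
    (hS.map (forget₂ (FGModuleCat.{v} A) (ModuleCat.{v} A)))
  let f := restrictMap k S.f
  let g := restrictMap k S.g
  have hfg : LinearMap.ker g = LinearMap.range f := by
    ext x
    exact h x
  have h := LinearMap.finrank_range_add_finrank_ker g
  rw [hfg] at h
  have hf := LinearMap.finrank_range_le f
  have hg := Submodule.finrank_le (LinearMap.range g)
  unfold dim restrict at *
  omega

lemma dim_biprod_le (M N : FGModuleCat.{v} A) : dim k (M ⊞ N) ≤ dim k M + dim k N :=
  dim_le_add_of_exact (S := .mk (biprod.inl : M ⟶ M ⊞ N) biprod.snd (by simp))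
    (ShortComplex.Splitting.ofHasBinaryBiproduct M N).exact

-- A k-basis of M generates it over A, so a free module of rank dim M suffices. The dimension
-- formula keeps the later resolutions uniformly bounded.
variable (k) in
lemma exists_projective_epi (M : FGModuleCat.{v} A) :
    ∃ (P : FGModuleCat.{v} A) (f : P ⟶ M), Projective P ∧ Epi f ∧
      dim k P = dim k M * Module.finrank k A := by
  have := finite_restrict (k := k) M
  let b : Module.Basis (Fin (dim k M)) k (restrict k M) :=
    Module.finBasisOfFinrankEq k _ rfl
  obtain ⟨f, hf⟩ := exists_free_epi M (ι := Fin (dim k M)) b (by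
    rw [eq_top_iff]
    intro x _
    have hx := b.mem_span x
    induction hx using Submodule.span_induction with
    | mem x hx => exact Submodule.subset_span hx
    | zero => exact Submodule.zero_mem _
    | add x y _ _ hx hy => exact Submodule.add_mem _ (hx trivial) (hy trivial)
    | smul a x _ hx => exact Submodule.smul_mem _ (algebraMap k A a) (hx trivial))
  refine ⟨_, f, projective_of_moduleProjective _, hf, ?_⟩
  let : Module k (FGModuleCat.of A (Fin (dim k M) → A)) :=
    inferInstanceAs (Module k (Fin (dim k M) → A))
  have : IsScalarTower k A (FGModuleCat.of A (Fin (dim k M) → A)) :=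
    inferInstanceAs (IsScalarTower k A (Fin (dim k M) → A))
  rw [dim_eq_finrank]
  exact (Module.finrank_pi_fintype k).trans (by simp)

end Dim

open scoped ZeroObject
open Pretriangulated Triangulated DerivedCategory

/-! ### Triangles in the derived category -/

section Abelian

variable {C : Type*} [Category* C] [Abelian C] [HasDerivedCategory.{w} C]

lemma exists_Q_map_eq (K L : CochainComplex C ℤ) [K.IsKProjective] (f : Q.obj K ⟶ Q.obj L) :
    ∃ g : K ⟶ L, Q.map g = f := by
  obtain ⟨g, hg⟩ := (CochainComplex.IsKProjective.Qh_map_bijective K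
    ((HomotopyCategory.quotient _ _).obj L)).surjective
      ((quotientCompQhIso C).hom.app K ≫ f ≫ (quotientCompQhIso C).inv.app L)
  obtain ⟨g, rfl⟩ := (HomotopyCategory.quotient _ _).map_surjective g
  refine ⟨g, ?_⟩
  rw [← cancel_epi ((quotientCompQhIso C).hom.app K), ← quotientCompQhIso_hom_naturality, hg]
  simp

lemma distinguished_of_iso₃ {X Y Z Z' : DerivedCategory C} {f : X ⟶ Y} {g : Y ⟶ Z}
    {h : Z ⟶ X⟦(1 : ℤ)⟧} (hT : Triangle.mk f g h ∈ distTriang _) (e : Z' ≅ Z) :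
    Triangle.mk f (g ≫ e.inv) (e.hom ≫ h) ∈ distTriang _ := by
  refine isomorphic_distinguished _ hT _ (Triangle.isoMk _ _ (Iso.refl _) (Iso.refl _) e ?_ ?_ ?_)
  · exact (Category.comp_id _).trans (Category.id_comp _).symm
  · change (g ≫ e.inv) ≫ e.hom = 𝟙 _ ≫ g
    simp
  · change (e.hom ≫ h) ≫ (𝟙 X)⟦(1 : ℤ)⟧' = _
    rw [CategoryTheory.Functor.map_id]
    exact Category.comp_id _

lemma exists_iso_Q_mappingCone {T : Triangle (DerivedCategory C)} (hT : T ∈ distTriang _)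
    {K L : CochainComplex C ℤ} [K.IsKProjective] (eK : Q.obj K ≅ T.obj₁) (eL : Q.obj L ≅ T.obj₂) :
    ∃ f : K ⟶ L, Nonempty (Q.obj (CochainComplex.mappingCone f) ≅ T.obj₃) := by
  obtain ⟨f, hf⟩ := exists_Q_map_eq K L (eK.hom ≫ T.mor₁ ≫ eL.inv)
  refine ⟨f, ⟨Triangle.π₃.mapIso (isoTriangleOfIso₁₂ _ _
    (mappingCone_triangle_distinguished f) hT eK eL ?_)⟩⟩
  change Q.map f ≫ eL.hom = _
  rw [hf, Category.assoc, Category.assoc, eL.inv_hom_id, Category.comp_id]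
  rfl

/-- Represent X by a complex; projectivity lifts g to its cycles, and a map into cycles is a map
from the single complex. -/
lemma exists_single_hom (X : DerivedCategory C) (q : ℤ) {P : C} [Projective P]
    (g : P ⟶ (homologyFunctor C q).obj X) [Epi g] :
    ∃ f : Q.obj ((HomologicalComplex.single C (.up ℤ) q).obj P) ⟶ X,
      Epi ((homologyFunctor C q).map f) := by
  let L := Q.objPreimage X
  let e : Q.obj L ≅ X := Q.objObjPreimageIso X
  let e' : L.homology q ≅ (homologyFunctor C q).obj X :=
    ((homologyFunctorFactors C q).app L).symm ≪≫ (homologyFunctor C q).mapIso e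
  let z : P ⟶ L.cycles q := Projective.factorThru (g ≫ e'.inv) (L.homologyπ q)
  have hz : z ≫ L.homologyπ q = g ≫ e'.inv := Projective.factorThru_comp _ _
  let φ : (HomologicalComplex.single C (.up ℤ) q).obj P ⟶ L :=
    HomologicalComplex.mkHomFromSingle (z ≫ L.iCycles q) (fun j _ ↦ by simp)
  have hφ : z = (HomologicalComplex.singleObjCyclesSelfIso (.up ℤ) q P).inv ≫
      HomologicalComplex.cyclesMap φ q := by
    rw [← cancel_mono (L.iCycles q)]
    simp [φ, HomologicalComplex.mkHomFromSingle_f]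
  have : Epi (HomologicalComplex.homologyMap φ q) := by
    refine epi_of_epi_fac (f := (HomologicalComplex.singleObjCyclesSelfIso (.up ℤ) q P).inv ≫
      HomologicalComplex.homologyπ _ q) (h := g ≫ e'.inv) ?_
    rw [← hz, hφ, Category.assoc, Category.assoc, HomologicalComplex.homologyπ_naturality]
  have : Epi ((homologyFunctor C q).map (Q.map φ)) := by
    have h := homologyFunctorFactors_hom_naturality φ q
    rw [(Iso.eq_comp_inv ((homologyFunctorFactors C q).app L)).2 h]
    exact epi_comp' (epi_comp' inferInstance this) inferInstance
  exact ⟨Q.map φ ≫ e.hom, by rw [Functor.map_comp]; infer_instance⟩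

/-- In degrees i ≥ r the long exact sequence makes H^i of the second map epi, as H^(i+1) of the
first object vanishes. It is also zero: for i = r because the first map is epi on H^r, beyond r
because its source vanishes. -/
lemma isLE_of_epi_homology {T : Triangle (DerivedCategory C)} (hT : T ∈ distTriang _) {q r : ℤ}
    (hr : q + 1 = r) (h₁ : T.obj₁.IsLE r) (h₂ : T.obj₂.IsLE r)
    (h : Epi ((homologyFunctor C r).map T.mor₁)) : T.obj₃.IsLE q := by
  subst hr
  rw [isLE_iff]
  intro i hi
  have h₁ : IsZero ((homologyFunctor C (i + 1)).obj T.obj₁) :=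
    isZero_of_isLE _ (q + 1) _ (by lia)
  have : Epi ((homologyFunctor C i).map T.mor₂) :=
    (HomologySequence.epi_homologyMap_mor₂_iff T hT i (i + 1)).2 (h₁.eq_of_tgt _ _)
  refine IsZero.of_epi_eq_zero ((homologyFunctor C i).map T.mor₂) ?_
  obtain rfl | hi := (show q + 1 ≤ i from hi).eq_or_lt
  · exact (HomologySequence.epi_homologyMap_mor₁_iff T hT _).1 inferInstance
  · exact (isZero_of_isLE _ (q + 1) _ hi).eq_of_src _ _

end Abelian

/-! ### Perfect complexes of bounded size and approximation by them -/

section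

variable (k : Type u) [Field k] {A : Type v} [Ring A] [Algebra k A] [FiniteDimensional k A]
  [IsNoetherianRing A]

/-- The complexes of finitely generated projective modules which are concentrated in the
degrees `p, …, q` and whose terms have dimension at most `N`. -/
structure IsBoundedPerfect (p q : ℤ) (N : ℕ) (K : CochainComplex (FGModuleCat.{v} A) ℤ) :
    Prop where
  projective (i : ℤ) : Projective (K.X i)
  isStrictlyGE : K.IsStrictlyGE p
  isStrictlyLE : K.IsStrictlyLE q
  dim_le (i : ℤ) : dim k (K.X i) ≤ N

variable {k}

lemma dim_homology_le (K : CochainComplex (FGModuleCat.{v} A) ℤ) (i : ℤ) :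
    dim k (K.homology i) ≤ dim k (K.X i) :=
  (dim_le_of_epi (K.homologyπ i)).trans (dim_le_of_mono (K.iCycles i))

namespace IsBoundedPerfect

variable {p q : ℤ} {N : ℕ} {K : CochainComplex (FGModuleCat.{v} A) ℤ}

lemma isKProjective (hK : IsBoundedPerfect k p q N K) : K.IsKProjective := by
  have := hK.projective
  have := hK.isStrictlyLE
  exact K.isKProjective_of_projective q

lemma isZero_X (hK : IsBoundedPerfect k p q N K) {i : ℤ} (hi : i ∉ Finset.Icc p q) :
    IsZero (K.X i) := by
  have := hK.isStrictlyGE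
  have := hK.isStrictlyLE
  rw [Finset.mem_Icc, not_and_or] at hi
  obtain hi | hi := hi
  · exact K.isZero_of_isStrictlyGE p i
  · exact K.isZero_of_isStrictlyLE q i

lemma mono (hK : IsBoundedPerfect k p q N K) {p' q' : ℤ} {N' : ℕ} (hp : p' ≤ p) (hq : q ≤ q')
    (hN : N ≤ N') : IsBoundedPerfect k p' q' N' K where
  projective := hK.projective
  isStrictlyGE := have := hK.isStrictlyGE; K.isStrictlyGE_of_ge _ _ hp
  isStrictlyLE := have := hK.isStrictlyLE; K.isStrictlyLE_of_le _ _ hq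
  dim_le i := (hK.dim_le i).trans hN

lemma shift (hK : IsBoundedPerfect k p q N K) (a : ℤ) {p' q' : ℤ} (hp : a + p' = p)
    (hq : a + q' = q) : IsBoundedPerfect k p' q' N (K⟦a⟧) where
  projective i := hK.projective (i + a)
  isStrictlyGE := have := hK.isStrictlyGE; K.isStrictlyGE_shift p a p' hp
  isStrictlyLE := have := hK.isStrictlyLE; K.isStrictlyLE_shift q a q' hq
  dim_le i := hK.dim_le (i + a)

lemma mappingCone (hK : IsBoundedPerfect k p q N K) {p' q' : ℤ} {N' : ℕ}
    {L : CochainComplex (FGModuleCat.{v} A) ℤ} (hL : IsBoundedPerfect k p' q' N' L)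
    (f : K ⟶ L) {p'' q'' : ℤ} (h₁ : p'' + 1 ≤ p) (h₂ : p'' ≤ p') (h₃ : q ≤ q'' + 1)
    (h₄ : q' ≤ q'') :
    IsBoundedPerfect k p'' q'' (N + N') (CochainComplex.mappingCone f) where
  projective i := by
    have := hK.projective (i + 1)
    have := hL.projective i
    exact Projective.of_iso (HomologicalComplex.homotopyCofiber.XIsoBiprod f i (i + 1) rfl).symm
      inferInstance
  isStrictlyGE := by
    rw [CochainComplex.isStrictlyGE_iff]
    intro i hi
    have := hK.isStrictlyGE
    have := hL.isStrictlyGE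
    refine IsZero.of_iso ?_ (HomologicalComplex.homotopyCofiber.XIsoBiprod f i (i + 1) rfl)
    rw [biprod_isZero_iff]
    exact ⟨K.isZero_of_isStrictlyGE p _, L.isZero_of_isStrictlyGE p' _⟩
  isStrictlyLE := by
    rw [CochainComplex.isStrictlyLE_iff]
    intro i hi
    have := hK.isStrictlyLE
    have := hL.isStrictlyLE
    refine IsZero.of_iso ?_ (HomologicalComplex.homotopyCofiber.XIsoBiprod f i (i + 1) rfl)
    rw [biprod_isZero_iff]
    exact ⟨K.isZero_of_isStrictlyLE q _, L.isZero_of_isStrictlyLE q' _⟩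
  dim_le i := by
    refine (dim_eq_of_iso (HomologicalComplex.homotopyCofiber.XIsoBiprod f i (i + 1) rfl)).le.trans ?_
    exact (dim_biprod_le _ _).trans (add_le_add (hK.dim_le _) (hL.dim_le _))

lemma single (P : FGModuleCat.{v} A) [Projective P] (q : ℤ) :
    IsBoundedPerfect k q q (dim k P) ((HomologicalComplex.single _ (.up ℤ) q).obj P) where
  projective i := by
    by_cases hi : i = q
    · exact Projective.of_iso (HomologicalComplex.singleObjXIsoOfEq _ q P i hi).symm inferInstance
    · exact (HomologicalComplex.isZero_single_obj_X _ q P i hi).projective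
  isStrictlyGE := inferInstance
  isStrictlyLE := inferInstance
  dim_le i := by
    by_cases hi : i = q
    · exact (dim_eq_of_iso (HomologicalComplex.singleObjXIsoOfEq _ q P i hi)).le
    · rw [dim_eq_zero_iff.2 (HomologicalComplex.isZero_single_obj_X (.up ℤ) q P i hi)]
      exact Nat.zero_le _

end IsBoundedPerfect

variable [HasDerivedCategory.{w} (FGModuleCat.{v} A)]

lemma dim_homology_Q_obj_le (K : CochainComplex (FGModuleCat.{v} A) ℤ) (i : ℤ) :
    dim k ((homologyFunctor _ i).obj (Q.obj K)) ≤ dim k (K.X i) :=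
  (dim_eq_of_iso ((homologyFunctorFactors _ i).app K)).le.trans (dim_homology_le K i)

lemma dim_homology_obj₃_le {T : Triangle (DerivedCategory (FGModuleCat.{v} A))}
    (hT : T ∈ distTriang _) (i : ℤ) :
    dim k ((homologyFunctor _ i).obj T.obj₃) ≤
      dim k ((homologyFunctor _ i).obj T.obj₂) + dim k ((homologyFunctor _ (i + 1)).obj T.obj₁) :=
  dim_le_add_of_exact (HomologySequence.exact₃ T hT i (i + 1))

-- Each step covers the top cohomology of X by a projective and replaces X by the cone. The bound N'
-- depends on neither M nor b, which is what later reduces finiteness to complexes of one fixed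
-- size.
variable (k A) in
lemma exists_perfect_approximation (l N : ℕ) : ∃ N' : ℕ, ∀ (b : ℤ)
    (M : DerivedCategory (FGModuleCat.{v} A)), M.IsLE b →
    (∀ i, dim k ((homologyFunctor _ i).obj M) ≤ N) →
    ∃ (X : DerivedCategory (FGModuleCat.{v} A)) (K : CochainComplex (FGModuleCat.{v} A) ℤ)
      (f : M ⟶ X) (g : X ⟶ Q.obj K) (h : Q.obj K ⟶ M⟦(1 : ℤ)⟧),
      Triangle.mk f g h ∈ distTriang _ ∧ X.IsLE (b - l) ∧
      (∀ i, dim k ((homologyFunctor _ i).obj X) ≤ N') ∧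
      IsBoundedPerfect k (b - l) (b - 1) N' K := by
  induction l with
  | zero =>
    refine ⟨N, fun b M hM hN ↦ ⟨M, 0, 𝟙 M, _, _, distinguished_of_iso₃
      (contractible_distinguished M) (Q.map_isZero (isZero_zero _)).isoZero,
      by simpa using hM, hN, ?_⟩⟩
    · have h (i : ℤ) : IsZero ((0 : CochainComplex (FGModuleCat.{v} A) ℤ).X i) :=
        (HomologicalComplex.eval _ _ i).map_isZero (isZero_zero _)
      exact
        { projective i := (h i).projective
          isStrictlyGE := (CochainComplex.isStrictlyGE_iff _ _).2 fun i _ ↦ h i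
          isStrictlyLE := (CochainComplex.isStrictlyLE_iff _ _).2 fun i _ ↦ h i
          dim_le i := by rw [dim_eq_zero_iff.2 (h i)]; exact Nat.zero_le _ }
  | succ l ih =>
    obtain ⟨N', hN'⟩ := ih
    refine ⟨N' * Module.finrank k A + N', fun b M hM hN ↦ ?_⟩
    obtain ⟨X, K, f, g, h, hT, hX, hXN, hK⟩ := hN' b M hM hN
    obtain ⟨P, π, _, _, hP⟩ := exists_projective_epi k ((homologyFunctor _ (b - l)).obj X)
    have hP : dim k P ≤ N' * Module.finrank k A :=
      hP.le.trans (Nat.mul_le_mul_right _ (hXN _))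
    obtain ⟨p, hp⟩ := exists_single_hom X (b - l) π
    obtain ⟨Y, u, v, hT'⟩ := distinguished_cocone_triangle p
    obtain ⟨Z, v', w', hT''⟩ := distinguished_cocone_triangle (f ≫ u)
    -- The octahedron on M → X → Y shows that the new third term is the cone of a map from P, placed
    -- in degree b - l, to the old K; it is thus again represented by a bounded complex of
    -- projectives.
    have O := someOctahedron rfl hT (rot_of_distTriang _ hT') hT''
    have hb : b - l = b - (l + 1 : ℕ) + 1 := by push_cast; ring
    have hPb := IsBoundedPerfect.single (k := k) P (b - l)
    have := hPb.isKProjective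
    obtain ⟨φ, ⟨e⟩⟩ := exists_iso_Q_mappingCone (inv_rot_of_distTriang _ O.mem)
      ((shiftEquiv (DerivedCategory (FGModuleCat.{v} A)) (1 : ℤ)).unitIso.app _) (Iso.refl (Q.obj K))
    refine ⟨Y, CochainComplex.mappingCone φ, f ≫ u, _, _, distinguished_of_iso₃ hT'' e,
      ?_, ?_, ?_⟩
    · exact isLE_of_epi_homology hT' hb.symm
        (inferInstanceAs ((Q.obj ((HomologicalComplex.single _ (.up ℤ) (b - l)).obj P)).IsLE (b - l)))
        hX hp
    · intro i
      have h₁ := (dim_homology_Q_obj_le (k := k) _ (i + 1)).trans (hPb.dim_le (i + 1))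
      exact (dim_homology_obj₃_le (k := k) hT' i).trans
        ((add_le_add (hXN i) (h₁.trans hP)).trans (add_comm _ _).le)
    · exact (hPb.mappingCone hK φ (by lia) (by lia) (by lia) (by lia)).mono le_rfl le_rfl (by lia)

variable (k A) in
/-- Objects with bounded cohomology are determined by perfect complexes of bounded size. -/
lemma exists_perfect_truncGE (a b : ℤ) (N : ℕ) : ∃ (p q : ℤ) (N' : ℕ),
    ∀ (M : DerivedCategory (FGModuleCat.{v} A)), M.IsGE a → M.IsLE b →
    (∀ i, dim k ((homologyFunctor _ i).obj M) ≤ N) →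
    ∃ K : CochainComplex (FGModuleCat.{v} A) ℤ, IsBoundedPerfect k p q N' K ∧
      Nonempty (M⟦(1 : ℤ)⟧ ≅ (TStructure.t.truncGE (a - 1)).obj (Q.obj K)) := by
  -- Chosen so that X lives in degrees ≤ a - 2 and hence disappears on truncating to degrees ≥ a -
  -- 1, where M[1] already lives.
  let l := (b - a + 2).toNat
  obtain ⟨N', hN'⟩ := exists_perfect_approximation k A l N
  refine ⟨b - l, b - 1, N', fun M hM₁ hM₂ hN ↦ ?_⟩
  obtain ⟨X, K, f, g, h, hT, hX, -, hK⟩ := hN' b M hM₂ hN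
  refine ⟨K, hK, ?_⟩
  have hX' : X.IsLE (a - 2) := TStructure.t.isLE_of_le _ (b - l) _ (by lia)
  have h₁ : IsIso ((TStructure.t.truncGE (a - 1)).map h) :=
    TStructure.t.isIso₂_truncGE_map_of_isLE _ (rot_of_distTriang _ hT) (a - 2) (a - 1) (by lia) hX'
  have h₂ : TStructure.t.IsGE (M⟦(1 : ℤ)⟧) (a - 1) := TStructure.t.isGE_shift M a 1 (a - 1)
  have h₃ := (TStructure.t.isGE_iff_isIso_truncGEπ_app _ _).1 h₂
  exact ⟨asIso ((TStructure.t.truncGEπ (a - 1)).app (M⟦(1 : ℤ)⟧)) ≪≫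
    (asIso ((TStructure.t.truncGE (a - 1)).map h)).symm⟩

end

/-! ### Transferring finiteness up to isomorphism -/

section Finiteness

variable {C D : Type*} [Category* C] [Category* D]

/-- A relation that reflects isomorphism is enough, with no functor needed: for each representative
y, choose one X related to an object isomorphic to y. -/
lemma FiniteUpToIso.of_rel {P : ObjectProperty C} {P' : ObjectProperty D} (hP' : FiniteUpToIso P')
    (R : C → D → Prop) (h₁ : ∀ X, P X → ∃ Y, P' Y ∧ R X Y)
    (h₂ : ∀ X X' Y Y', R X Y → R X' Y' → Nonempty (Y ≅ Y') → Nonempty (X ≅ X')) :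
    FiniteUpToIso P := by
  obtain ⟨S, hS, hPS⟩ := hP'
  refine ⟨{X | ∃ y ∈ S, ∃ h : ∃ X Y, R X Y ∧ Nonempty (Y ≅ y), X = h.choose}, ?_, fun X hX ↦ ?_⟩
  · have : {X | ∃ y ∈ S, ∃ h : ∃ X Y, R X Y ∧ Nonempty (Y ≅ y), X = h.choose} =
        ⋃ y ∈ S, {X | ∃ h : ∃ X Y, R X Y ∧ Nonempty (Y ≅ y), X = h.choose} := by
      ext; simp
    rw [this]
    refine hS.biUnion fun y _ ↦ Set.Subsingleton.finite ?_
    rintro _ ⟨_, rfl⟩ _ ⟨_, rfl⟩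
    rfl
  · obtain ⟨Y, hY, hXY⟩ := h₁ X hX
    obtain ⟨y, hy, ⟨e⟩⟩ := hPS Y hY
    have h : ∃ X Y, R X Y ∧ Nonempty (Y ≅ y) := ⟨X, Y, hXY, ⟨e⟩⟩
    obtain ⟨Y', hXY', ⟨e'⟩⟩ := h.choose_spec
    exact ⟨_, ⟨y, hy, h, rfl⟩, h₂ _ _ _ _ hXY hXY' ⟨e ≪≫ e'.symm⟩⟩

lemma FiniteUpToIso.mono {P P' : ObjectProperty C} (hP' : FiniteUpToIso P') (h : P ≤ P') :
    FiniteUpToIso P := by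
  obtain ⟨S, hS, hPS⟩ := hP'
  exact ⟨S, hS, fun X hX ↦ hPS X (h X hX)⟩

lemma FiniteUpToIso.biUnion {ι : Type*} {s : Set ι} (hs : s.Finite) {P : ι → ObjectProperty C}
    (hP : ∀ i, FiniteUpToIso (P i)) : FiniteUpToIso fun X : C ↦ ∃ i ∈ s, P i X := by
  choose S hS hPS using hP
  refine ⟨⋃ i ∈ s, S i, hs.biUnion fun i _ ↦ hS i, fun X ⟨i, hi, hX⟩ ↦ ?_⟩
  obtain ⟨Y, hY, e⟩ := hPS i X hX
  exact ⟨Y, Set.mem_biUnion hi hY, e⟩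

end Finiteness

/-! ### The embedding of K^b(A-proj) in the derived category -/

section

variable (A : Type v) [Ring A]

/-- The inclusion of complexes of finitely generated projective modules into complexes
of finitely generated modules. -/
abbrev complexInclusion :
    CochainComplex (Proj A) ℤ ⥤ CochainComplex (FGModuleCat.{v} A) ℤ :=
  (projInclusion A).mapHomologicalComplex (.up ℤ)

variable [IsNoetherianRing A]

variable {A} in
/-- A complex of projective objects in the category of finitely generated modules, seen as a
complex of finitely generated projective modules. -/
abbrev liftProj (K : CochainComplex (FGModuleCat.{v} A) ℤ) (hK : ∀ i, Projective (K.X i)) :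
    CochainComplex (Proj A) ℤ where
  X i := ⟨K.X i, have := hK i; moduleProjective_of_projective (K.X i)⟩
  d i j := ObjectProperty.homMk (K.d i j)
  shape i j hij := by
    ext : 1
    exact K.shape i j hij
  d_comp_d' i j l _ _ := by
    ext : 1
    exact K.d_comp_d i j l

variable {A} in
lemma liftProj_isStrictlyGE (K : CochainComplex (FGModuleCat.{v} A) ℤ)
    (hK : ∀ i, Projective (K.X i)) (p : ℤ) [K.IsStrictlyGE p] : (liftProj K hK).IsStrictlyGE p := by
  rw [CochainComplex.isStrictlyGE_iff]
  exact fun i hi ↦ IsZero.of_full_of_faithful_of_isZero (projInclusion A) ((liftProj K hK).X i)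
    (K.isZero_of_isStrictlyGE p i hi)

variable {A} in
lemma liftProj_isStrictlyLE (K : CochainComplex (FGModuleCat.{v} A) ℤ)
    (hK : ∀ i, Projective (K.X i)) (p : ℤ) [K.IsStrictlyLE p] : (liftProj K hK).IsStrictlyLE p := by
  rw [CochainComplex.isStrictlyLE_iff]
  exact fun i hi ↦ IsZero.of_full_of_faithful_of_isZero (projInclusion A) ((liftProj K hK).X i)
    (K.isZero_of_isStrictlyLE p i hi)

variable {A} in
lemma isKProjective_complexInclusion {K : CochainComplex (Proj A) ℤ} (hK : isBoundedComplex A K) :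
    ((complexInclusion A).obj K).IsKProjective := by
  obtain ⟨_, b, _, hb⟩ := hK
  have (i : ℤ) : Projective (((complexInclusion A).obj K).X i) :=
    have : Module.Projective A (((complexInclusion A).obj K).X i) := (K.X i).property
    projective_of_moduleProjective _
  have : ((complexInclusion A).obj K).IsStrictlyLE b := inferInstance
  exact CochainComplex.isKProjective_of_projective _ b

variable [HasDerivedCategory.{w} (FGModuleCat.{v} A)]

/-- The canonical functor from the homotopy category of bounded complexes of finitely
generated projective modules to the derived category. -/
def Kb.toDerived : Kb A ⥤ DerivedCategory (FGModuleCat.{v} A) :=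
  ObjectProperty.ι _ ⋙ (projInclusion A).mapHomotopyCategory (.up ℤ) ⋙ Qh

/-- The canonical functor from `Kb A` to the derived category preserves cohomology. -/
def Kb.toDerivedCompHomology (i : ℤ) :
    Kb.toDerived A ⋙ homologyFunctor _ i ≅ Kb.cohomology A i :=
  Functor.isoWhiskerLeft (ObjectProperty.ι _ ⋙ (projInclusion A).mapHomotopyCategory (.up ℤ))
    (homologyFunctorFactorsh (FGModuleCat.{v} A) i)

/-- The object of `Kb A` given by a bounded complex. -/
abbrev Kb.of {A : Type v} [Ring A] (K : CochainComplex (Proj A) ℤ) (hK : isBoundedComplex A K) :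
    Kb A :=
  ⟨(HomotopyCategory.quotient _ _).obj K, ObjectProperty.strictMap_obj _ _ hK⟩

variable {A}

/-- Both inclusions are fully faithful, and localization is bijective on morphisms out of a
K-projective complex, such as a bounded complex of projectives. -/
lemma Kb.toDerived_map_bijective (X Y : Kb A) :
    Function.Bijective ((Kb.toDerived A).map : (X ⟶ Y) → _) := by
  obtain ⟨_, K, hK⟩ := X
  have := isKProjective_complexInclusion hK
  refine ((CochainComplex.IsKProjective.Qh_map_bijective ((complexInclusion A).obj K)
    (((projInclusion A).mapHomotopyCategory (.up ℤ)).obj Y.obj)).comp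
    ((Functor.FullyFaithful.ofFullyFaithful
      ((projInclusion A).mapHomotopyCategory (.up ℤ))).map_bijective _ _)).comp
    ((ObjectProperty.fullyFaithfulι _).map_bijective _ _)

lemma Kb.nonempty_iso {X Y : Kb A}
    (e : (Kb.toDerived A).obj X ≅ (Kb.toDerived A).obj Y) : Nonempty (X ≅ Y) := by
  obtain ⟨f, hf⟩ := (Kb.toDerived_map_bijective X Y).2 e.hom
  obtain ⟨g, hg⟩ := (Kb.toDerived_map_bijective Y X).2 e.inv
  refine ⟨⟨f, g, (Kb.toDerived_map_bijective X X).1 ?_, (Kb.toDerived_map_bijective Y Y).1 ?_⟩⟩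
  · simp [hf, hg]
  · simp [hf, hg]

lemma Kb.toDerived_bounded (X : Kb A) :
    (TStructure.t : TStructure (DerivedCategory (FGModuleCat.{v} A))).bounded
      ((Kb.toDerived A).obj X) := by
  obtain ⟨_, K, a, b, ha, hb⟩ := X
  have : ((complexInclusion A).obj K).IsStrictlyGE a := inferInstance
  have : ((complexInclusion A).obj K).IsStrictlyLE b := inferInstance
  let e : Q.obj ((complexInclusion A).obj K) ≅ (Kb.toDerived A).obj
      (Kb.of K ⟨a, b, ha, hb⟩) := ((quotientCompQhIso _).app _).symm
  exact ⟨⟨a, TStructure.t.isGE_of_iso e a⟩, ⟨b, TStructure.t.isLE_of_iso e b⟩⟩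

end

/-! ### Discreteness and perfect complexes of bounded size -/

section

variable (k : Type u) [Field k] (A : Type v) [Ring A] [Algebra k A] [FiniteDimensional k A]
  [IsNoetherianRing A] [HasDerivedCategory.{w} (FGModuleCat.{v} A)]

/-- Up to isomorphism in the derived category, there are only finitely many complexes of
finitely generated projective modules which are concentrated in the degrees `p, …, q` and whose
terms have dimension at most `N`. -/
def FiniteBoundedPerfect (p q : ℤ) (N : ℕ) : Prop :=
  FiniteUpToIso fun Y : DerivedCategory (FGModuleCat.{v} A) ↦
    ∃ K, IsBoundedPerfect k p q N K ∧ Nonempty (Y ≅ Q.obj K)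

end

section

variable {k : Type u} [Field k] {A : Type v} [Ring A] [Algebra k A] [FiniteDimensional k A]

lemma exists_bounds (n : ℤ →₀ ℕ) :
    ∃ (a b : ℤ) (N : ℕ), (∀ i, n i ≤ N) ∧ (∀ i < a, n i = 0) ∧ (∀ i > b, n i = 0) := by
  obtain ⟨a, ha⟩ := n.support.bddBelow
  obtain ⟨b, hb⟩ := n.support.bddAbove
  refine ⟨a, b, n.sum fun _ x ↦ x, fun i ↦ ?_, fun i hi ↦ ?_, fun i hi ↦ ?_⟩
  · by_cases hi : i ∈ n.support
    · exact Finset.single_le_sum (f := n) (fun _ _ ↦ Nat.zero_le _) hi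
    · rw [Finsupp.notMem_support_iff.1 hi]
      exact Nat.zero_le _
  · by_contra h
    exact (ha (Finsupp.mem_support_iff.2 h)).not_gt hi
  · by_contra h
    exact (hb (Finsupp.mem_support_iff.2 h)).not_gt hi

lemma isDerivedDiscrete_of_finiteBoundedPerfect
    (h : haveI : IsNoetherianRing A := IsNoetherianRing.of_finite k A
      letI := HasDerivedCategory.standard (FGModuleCat.{v} A)
      ∀ (p q : ℤ) (N : ℕ), FiniteBoundedPerfect k A p q N) : IsDerivedDiscrete k A := by
  have : IsNoetherianRing A := IsNoetherianRing.of_finite k A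
  let := HasDerivedCategory.standard (FGModuleCat.{v} A)
  intro n
  obtain ⟨a, b, N, hN, ha, hb⟩ := exists_bounds n
  obtain ⟨p, q, N', H⟩ := exists_perfect_truncGE k A a b N
  refine (h p q N').of_rel
    (fun M Y ↦ Nonempty (M.obj⟦(1 : ℤ)⟧ ≅ (TStructure.t.truncGE (a - 1)).obj Y)) ?_ ?_
  · intro M hM
    obtain ⟨K, hK, hMK⟩ := H M.obj
      ((isGE_iff _ _).2 fun i hi ↦ dim_eq_zero_iff.1 ((hM i).trans (ha i hi)))
      ((isLE_iff _ _).2 fun i hi ↦ dim_eq_zero_iff.1 ((hM i).trans (hb i hi)))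
      (fun i ↦ (hM i).le.trans (hN i))
    exact ⟨_, ⟨K, hK, ⟨Iso.refl _⟩⟩, hMK⟩
  -- Isomorphic perfect complexes have isomorphic truncations, and the shift is an equivalence, so M
  -- is recovered.
  · rintro M M' Y Y' ⟨e⟩ ⟨e'⟩ ⟨f⟩
    exact ⟨(ObjectProperty.fullyFaithfulι _).preimageIso
      ((shiftFunctor (DerivedCategory (FGModuleCat.{v} A)) (1 : ℤ)).preimageIso
        (e ≪≫ (TStructure.t.truncGE (a - 1)).mapIso f ≪≫ e'.symm))⟩

lemma isKbDiscrete_of_isDerivedDiscrete (h : IsDerivedDiscrete k A) : IsKbDiscrete k A := by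
  have : IsNoetherianRing A := IsNoetherianRing.of_finite k A
  let := HasDerivedCategory.standard (FGModuleCat.{v} A)
  intro n
  refine (h n).of_rel (fun X M ↦ Nonempty ((Kb.toDerived A).obj X ≅ M.obj)) ?_ ?_
  · intro X hX
    refine ⟨⟨(Kb.toDerived A).obj X, Kb.toDerived_bounded X⟩, fun i ↦ ?_, ⟨Iso.refl _⟩⟩
    exact (dim_eq_of_iso ((Kb.toDerivedCompHomology A i).app X)).trans (hX i)
  · rintro X X' M M' ⟨e⟩ ⟨e'⟩ ⟨f⟩
    exact Kb.nonempty_iso (e ≪≫ (ObjectProperty.ι _).mapIso f ≪≫ e'.symm)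

lemma finiteBoundedPerfect_of_isKbDiscrete [IsNoetherianRing A]
    [HasDerivedCategory.{w} (FGModuleCat.{v} A)] (h : IsKbDiscrete k A) (p q : ℤ) (N : ℕ) :
    FiniteBoundedPerfect k A p q N := by
  let n₀ : ℤ →₀ ℕ := Finsupp.onFinset (Finset.Icc p q)
    (fun i ↦ if i ∈ Finset.Icc p q then N else 0) (fun i hi ↦ by by_contra h; simp [h] at hi)
  -- Cohomology is a subquotient of the terms, so its dimension vector is one of the finitely many
  -- below `n₀`.
  refine (FiniteUpToIso.biUnion (Set.finite_Iic n₀) h).of_rel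
    (fun Y X ↦ Nonempty (Y ≅ (Kb.toDerived A).obj X)) ?_ ?_
  · rintro Y ⟨K, hK, ⟨e⟩⟩
    have := hK.isStrictlyGE
    have := hK.isStrictlyLE
    let X : Kb A := Kb.of (liftProj K hK.projective)
      ⟨p, q, liftProj_isStrictlyGE _ _ _, liftProj_isStrictlyLE _ _ _⟩
    have e' : Q.obj K ≅ (Kb.toDerived A).obj X := ((quotientCompQhIso _).app K).symm
    let d (i : ℤ) : ℕ := dim k ((Kb.cohomology A i).obj X)
    have hd (i : ℤ) : d i ≤ dim k (K.X i) :=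
      ((dim_eq_of_iso ((Kb.toDerivedCompHomology A i).app X)).symm.trans
        (dim_eq_of_iso ((homologyFunctor _ i).mapIso e'.symm))).le.trans (dim_homology_Q_obj_le K i)
    have hd' (i : ℤ) : d i ≤ n₀ i := by
      change _ ≤ if i ∈ Finset.Icc p q then N else 0
      split_ifs with hi
      · exact (hd i).trans (hK.dim_le i)
      · refine (hd i).trans (dim_eq_zero_iff.2 (hK.isZero_X hi)).le
    refine ⟨X, ⟨Finsupp.onFinset (Finset.Icc p q) d fun i hi ↦ ?_, hd', fun i ↦ rfl⟩, ⟨e ≪≫ e'⟩⟩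
    by_contra hi'
    have := hd' i
    simp only [n₀, Finsupp.onFinset_apply, hi', if_false] at this
    omega
  · rintro Y Y' X X' ⟨e⟩ ⟨e'⟩ ⟨f⟩
    exact ⟨e ≪≫ (Kb.toDerived A).mapIso f ≪≫ e'.symm⟩

end

/-! ### Reduction to homotopy minimal complexes -/

section Abelian

variable {C : Type*} [Category* C] [Abelian C]

/-- The square of i ≫ p factors through p ≫ i, so its image in the derived category is both zero and
an automorphism. -/
lemma isZero_Q_obj_of_isIso_comp [HasDerivedCategory.{w} C] {K W : CochainComplex C ℤ} (p : K ⟶ W)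
    (i : W ⟶ K) [IsIso (i ≫ p)] (h : Q.map (p ≫ i) = 0) : IsZero (Q.obj W) := by
  have h₁ : Q.map (i ≫ p) ≫ Q.map (i ≫ p) = 0 := by
    rw [← Q.map_comp, Category.assoc, ← Category.assoc p, Q.map_comp, Q.map_comp, h]
    simp
  rw [IsZero.iff_id_eq_zero, ← cancel_epi (Q.map (i ≫ p) ≫ Q.map (i ≫ p))]
  rw [h₁, zero_comp, zero_comp]

/-- The kernel of a split epimorphism is a retract. -/
def kernelRetract {K W : C} (p : K ⟶ W) (i : W ⟶ K) [IsIso (i ≫ p)] :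
    Retract (kernel p) K where
  i := kernel.ι p
  r := kernel.lift p (𝟙 K - p ≫ inv (i ≫ p) ≫ i) (by simp)
  retract := by
    rw [← cancel_mono (kernel.ι p)]
    simp

lemma isIso_Q_map_kernel_ι [HasDerivedCategory.{w} C] {K W : CochainComplex C ℤ} (p : K ⟶ W)
    [Epi p] (h : IsZero (Q.obj W)) : IsIso (Q.map (kernel.ι p)) := by
  have hS : (ShortComplex.mk (kernel.ι p) p (kernel.condition p)).ShortExact :=
    { exact := ShortComplex.exact_kernel p }
  exact (Triangle.isZero₃_iff_isIso₁ _ (triangleOfSES_distinguished hS)).1 h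

end Abelian

section

variable {A : Type v} [Ring A] [IsNoetherianRing A]

/-- Here ker (p ≫ i) = ker p and its range is that of i, so p restricts to an isomorphism on the
complement i(W) of ker p. -/
lemma isIso_comp_of_isCompl {M W : FGModuleCat.{v} A} (p : M ⟶ W) (i : W ⟶ M) [Epi p] [Mono i]
    (h : IsCompl (LinearMap.ker (p ≫ i).hom.hom) (LinearMap.range (p ≫ i).hom.hom)) :
    IsIso (i ≫ p) := by
  have hp := surjective_of_epi p
  have hi := injective_of_mono i
  refine isIso_of_bijective _ ⟨?_, fun w ↦ ?_⟩
  · refine (injective_iff_map_eq_zero (i ≫ p).hom.hom).2 fun w hw ↦ ?_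
    obtain ⟨x, rfl⟩ := hp w
    refine hi ?_
    rw [map_zero]
    refine Submodule.disjoint_def.1 h.disjoint _ ?_ ⟨x, rfl⟩
    exact (congr_arg i.hom.hom hw).trans (map_zero _)
  · obtain ⟨x, rfl⟩ := hp w
    obtain ⟨a, ha, _, ⟨y, rfl⟩, rfl⟩ := Submodule.mem_sup.1
      (h.codisjoint.eq_top ▸ Submodule.mem_top : x ∈ _)
    refine ⟨p.hom.hom y, ?_⟩
    have : p.hom.hom a = 0 := hi (Eq.trans ha (map_zero _).symm)
    rw [map_add, this, zero_add]
    rfl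

lemma hom_f_pow {K : CochainComplex (FGModuleCat.{v} A) ℤ} (e : End K) (n : ℕ) (j : ℤ) :
    ((e ^ n : End K).f j).hom.hom = ((e.f j).hom.hom : Module.End A (K.X j)) ^ n := by
  induction n with
  | zero => rfl
  | succ n ih =>
    rw [pow_succ, pow_succ, ← ih]
    rfl

/-- A complex of finitely generated modules is radical if the image of each differential lies in
the radical of its target. -/
def IsRadical (K : CochainComplex (FGModuleCat.{v} A) ℤ) : Prop :=
  ∀ i : ℤ, LinearMap.range (K.d i (i + 1)).hom.hom ≤ Module.jacobson A (K.X (i + 1)).obj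

/-- Some maximal submodule M misses the image of f, so P → P'/M is onto and P' → P'/M lifts to g.
Then g ≫ f is the identity modulo M, hence so are all its powers. -/
lemma exists_comp_pow_ne_zero {P P' : FGModuleCat.{v} A} [Projective P'] (f : P ⟶ P')
    (hf : ¬ LinearMap.range f.hom.hom ≤ Module.jacobson A P'.obj) :
    ∃ g : P' ⟶ P, ∀ n : ℕ, ((g ≫ f).hom.hom : Module.End A P') ^ n ≠ 0 := by
  obtain ⟨M, hM, hfM⟩ : ∃ M : Submodule A P', IsCoatom M ∧ ¬ LinearMap.range f.hom.hom ≤ M := by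
    by_contra! h
    exact hf (le_sInf h)
  have hP' := moduleProjective_of_projective P'
  have hsurj : Function.Surjective (M.mkQ ∘ₗ f.hom.hom) := by
    rw [← LinearMap.range_eq_top, LinearMap.range_comp]
    have h := hM.2 (M ⊔ LinearMap.range f.hom.hom)
      (lt_of_le_of_ne le_sup_left fun h ↦ hfM (h ▸ le_sup_right))
    rw [eq_top_iff, ← Submodule.range_mkQ M, ← Submodule.map_top, ← h, Submodule.map_sup]
    exact sup_le (by rw [Submodule.mkQ_map_self]; exact bot_le) le_rfl
  obtain ⟨g, hg⟩ := Module.projective_lifting_property _ M.mkQ hsurj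
  refine ⟨ConcreteCategory.ofHom (C := FGModuleCat A) g, fun n hn ↦ hM.1 ?_⟩
  have h (n : ℕ) : M.mkQ ∘ₗ ((f.hom.hom ∘ₗ g : Module.End A P') ^ n) = M.mkQ := by
    induction n with
    | zero => rfl
    | succ n ih =>
      rw [pow_succ, Module.End.mul_eq_comp, ← LinearMap.comp_assoc, ih, ← LinearMap.comp_assoc, hg]
  have h' := h n
  change ((f.hom.hom ∘ₗ g : Module.End A P') ^ n) = 0 at hn
  rw [hn, LinearMap.comp_zero] at h'
  rw [← M.ker_mkQ, ← h', LinearMap.ker_zero]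

lemma exists_homotopic_zero_pow_ne_zero {K : CochainComplex (FGModuleCat.{v} A) ℤ}
    (hK : ∀ i, Projective (K.X i)) (h : ¬ IsRadical K) :
    ∃ (e : End K) (j : ℤ), Nonempty (Homotopy e 0) ∧ ∀ n : ℕ, (e ^ n : End K).f j ≠ 0 := by
  obtain ⟨i, hi⟩ := not_forall.1 h
  have := hK (i + 1)
  obtain ⟨g, hg⟩ := exists_comp_pow_ne_zero (K.d i (i + 1)) hi
  -- A homotopy supported in the single degree i + 1, so that its boundary there is just g ≫ d.
  let s (a b : ℤ) (_ : (ComplexShape.up ℤ).Rel b a) : K.X a ⟶ K.X b :=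
    if h : a = i + 1 ∧ b = i then (K.XIsoOfEq h.1).hom ≫ g ≫ (K.XIsoOfEq h.2).inv else 0
  refine ⟨Homotopy.nullHomotopicMap' s, i + 1, ⟨Homotopy.nullHomotopy' s⟩, fun n hn ↦ hg n ?_⟩
  have hs : (Homotopy.nullHomotopicMap' s).f (i + 1) = g ≫ K.d i (i + 1) := by
    rw [Homotopy.nullHomotopicMap'_f (k₂ := i) (k₀ := i + 1 + 1) rfl rfl]
    simp [s]
  rw [← hs, ← hom_f_pow (Homotopy.nullHomotopicMap' s) n (i + 1), hn]
  rfl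

variable {k : Type u} [Field k] [Algebra k A] [FiniteDimensional k A]
  [HasDerivedCategory.{w} (FGModuleCat.{v} A)]

/-- Fitting's lemma in the finitely many nonzero degrees, with a common exponent. Writing it as n +
1 ensures that the power still contains a factor e. -/
lemma exists_isCompl_pow {p q : ℤ} {N : ℕ} {K : CochainComplex (FGModuleCat.{v} A) ℤ}
    (hK : IsBoundedPerfect k p q N K) (e : End K) :
    ∃ n : ℕ, ∀ j, IsCompl (LinearMap.ker ((e ^ (n + 1) : End K).f j).hom.hom)
      (LinearMap.range ((e ^ (n + 1) : End K).f j).hom.hom) := by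
  have hA : IsArtinianRing A := IsArtinianRing.of_finite k A
  have h := (Filter.eventually_all_finset (Finset.Icc p q)).2 fun j _ ↦
    LinearMap.eventually_isCompl_ker_pow_range_pow ((e.f j).hom.hom : Module.End A (K.X j))
  obtain ⟨n, hn⟩ := Filter.eventually_atTop.1 h
  refine ⟨n, fun j ↦ ?_⟩
  rw [hom_f_pow]
  by_cases hj : j ∈ Finset.Icc p q
  · exact hn (n + 1) (Nat.le_succ n) j hj
  · have := subsingleton_of_isZero (hK.isZero_X hj)
    exact isCompl_iff.2 ⟨disjoint_of_subsingleton, codisjoint_of_subsingleton⟩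

/-- A high power E of a null-homotopic, non-nilpotent endomorphism splits K into kernel and image.
The image vanishes in the derived category since E does, and the kernel is strictly smaller since E
is nonzero. -/
lemma exists_smaller_perfect {p q : ℤ} {N : ℕ} {K : CochainComplex (FGModuleCat.{v} A) ℤ}
    (hK : IsBoundedPerfect k p q N K) (h : ¬ IsRadical K) :
    ∃ K', IsBoundedPerfect k p q N K' ∧ Nonempty (Q.obj K' ≅ Q.obj K) ∧
      (∀ i, dim k (K'.X i) ≤ dim k (K.X i)) ∧ ∃ i, dim k (K'.X i) < dim k (K.X i) := by
  obtain ⟨e, j, ⟨he⟩, hj⟩ := exists_homotopic_zero_pow_ne_zero hK.projective h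
  obtain ⟨n, hn⟩ := exists_isCompl_pow hK e
  let E : K ⟶ K := (e ^ (n + 1) : End K)
  have h₀ : Q.map e = Q.map 0 := Q_map_eq_of_homotopy _ he
  have hE : Q.map E = 0 := by
    have : E = e ≫ (e ^ n : End K) := pow_succ e n
    rw [this, Q.map_comp, h₀, Q.map_zero, zero_comp]
  let p' := factorThruImage E
  let i' := image.ι E
  have hpi : p' ≫ i' = E := image.fac E
  have (l : ℤ) : IsIso ((i' ≫ p').f l) := by
    have hn := hn l
    change IsCompl (LinearMap.ker (E.f l).hom.hom) (LinearMap.range (E.f l).hom.hom) at hn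
    rw [← hpi] at hn
    exact isIso_comp_of_isCompl (p'.f l) (i'.f l) hn
  have : IsIso (i' ≫ p') := HomologicalComplex.Hom.isIso_of_components _
  have := isIso_Q_map_kernel_ι p' (isZero_Q_obj_of_isIso_comp p' i' (hpi.symm ▸ hE))
  have hdim (i : ℤ) : dim k ((kernel p').X i) ≤ dim k (K.X i) := dim_le_of_mono ((kernel.ι p').f i)
  have hzero (i : ℤ) (hi : IsZero (K.X i)) : IsZero ((kernel p').X i) :=
    IsZero.of_mono ((kernel.ι p').f i) hi
  refine ⟨kernel p', ?_, ⟨asIso (Q.map (kernel.ι p'))⟩, hdim, j, ?_⟩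
  · have := hK.isStrictlyGE
    have := hK.isStrictlyLE
    exact
      { projective i :=
          ((kernelRetract p' i').map (HomologicalComplex.eval _ _ i)).projective
            (p := hK.projective i)
        isStrictlyGE := (CochainComplex.isStrictlyGE_iff _ _).2 fun i hi ↦
          hzero i (K.isZero_of_isStrictlyGE p i hi)
        isStrictlyLE := (CochainComplex.isStrictlyLE_iff _ _).2 fun i hi ↦
          hzero i (K.isZero_of_isStrictlyLE q i hi)
        dim_le i := (hdim i).trans (hK.dim_le i) }
  · refine dim_lt_of_mono ((kernel.ι p').f j) fun _ ↦ hj (n + 1) ?_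
    have h : kernel.ι p' ≫ E = 0 :=
      (kernel.ι p' ≫= hpi.symm).trans (by rw [kernel.condition_assoc, zero_comp])
    rw [← cancel_epi ((kernel.ι p').f j), comp_zero]
    exact congr(HomologicalComplex.Hom.f $h j)

lemma exists_radical_perfect {p q : ℤ} {N : ℕ} {K : CochainComplex (FGModuleCat.{v} A) ℤ}
    (hK : IsBoundedPerfect k p q N K) :
    ∃ K', IsBoundedPerfect k p q N K' ∧ IsRadical K' ∧ Nonempty (Q.obj K ≅ Q.obj K') := by
  induction hn : ∑ i ∈ Finset.Icc p q, dim k (K.X i) using Nat.strong_induction_on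
    generalizing K with
  | _ n ih =>
    by_cases h : IsRadical K
    · exact ⟨K, hK, h, ⟨Iso.refl _⟩⟩
    obtain ⟨K', hK', ⟨e⟩, hle, i, hlt⟩ := exists_smaller_perfect hK h
    have hi : i ∈ Finset.Icc p q := by
      by_contra hi
      exact (Nat.zero_le _).not_gt (hlt.trans_eq (dim_eq_zero_iff.2 (hK.isZero_X hi)))
    obtain ⟨K'', hK'', hrad, ⟨e'⟩⟩ := ih _
      (hn ▸ Finset.sum_lt_sum (fun i _ ↦ hle i) ⟨i, hi, hlt⟩) hK' rfl
    exact ⟨K'', hK'', hrad, ⟨e.symm ≪≫ e'⟩⟩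

end

/-! ### From finitely many indecomposables to finitely many objects of bounded size -/

section Finiteness

variable {C D : Type*} [Category* C] [Category* D]

lemma FiniteUpToIso.of_subsingleton {P : ObjectProperty C}
    (h : ∀ X Y, P X → P Y → Nonempty (X ≅ Y)) : FiniteUpToIso P := by
  by_cases hP : ∃ X, P X
  · obtain ⟨X, hX⟩ := hP
    exact ⟨{X}, Set.finite_singleton X, fun Y hY ↦ ⟨X, rfl, h Y X hY hX⟩⟩
  · exact ⟨∅, Set.finite_empty, fun X hX ↦ (hP ⟨X, hX⟩).elim⟩

lemma FiniteUpToIso.or {P P' : ObjectProperty C} (hP : FiniteUpToIso P)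
    (hP' : FiniteUpToIso P') : FiniteUpToIso fun X ↦ P X ∨ P' X := by
  obtain ⟨S, hS, hPS⟩ := hP
  obtain ⟨S', hS', hPS'⟩ := hP'
  refine ⟨S ∪ S', hS.union hS', ?_⟩
  rintro X (hX | hX)
  · obtain ⟨Y, hY, e⟩ := hPS X hX
    exact ⟨Y, Or.inl hY, e⟩
  · obtain ⟨Y, hY, e⟩ := hPS' X hX
    exact ⟨Y, Or.inr hY, e⟩

lemma FiniteUpToIso.prod {P : ObjectProperty C} {P' : ObjectProperty D} (hP : FiniteUpToIso P)
    (hP' : FiniteUpToIso P') : FiniteUpToIso fun X : C × D ↦ P X.1 ∧ P' X.2 := by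
  obtain ⟨S, hS, hPS⟩ := hP
  obtain ⟨S', hS', hPS'⟩ := hP'
  refine ⟨S ×ˢ S', hS.prod hS', fun X hX ↦ ?_⟩
  obtain ⟨Y, hY, ⟨e⟩⟩ := hPS _ hX.1
  obtain ⟨Y', hY', ⟨e'⟩⟩ := hPS' _ hX.2
  exact ⟨(Y, Y'), ⟨hY, hY'⟩, ⟨Iso.prod e e'⟩⟩

/-- If there are finitely many indecomposable objects, there are finitely many objects of
a given size. -/
lemma IsOfFiniteRepresentationType.finiteUpToIso_size_le [HasZeroMorphisms C]
    (hC : IsOfFiniteRepresentationType C) (size : C → ℕ) (h₀ : ∀ X, size X = 0 → IsZero X)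
    (hb : ∀ (Y Z : C) (b : BinaryBicone Y Z), size Y + size Z ≤ size b.pt)
    (hiso : ∀ X Y : C, (X ≅ Y) → size X = size Y) (N : ℕ) :
    FiniteUpToIso fun X : C ↦ size X ≤ N := by
  have hz : FiniteUpToIso fun X : C ↦ IsZero X :=
    .of_subsingleton fun X Y hX hY ↦ ⟨hX.iso hY⟩
  induction N with
  | zero => exact hz.mono fun X hX ↦ h₀ X (Nat.le_zero.1 hX)
  | succ N ih =>
    -- A biproduct is determined by its summands. A decomposable object of size at most N + 1 has
    -- two nonzero summands, each therefore of size at most N.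
    have hsum : FiniteUpToIso fun X : C ↦ ∃ (Y Z : C) (b : BinaryBicone Y Z),
        Nonempty b.IsBilimit ∧ Nonempty (X ≅ b.pt) ∧ size Y ≤ N ∧ size Z ≤ N := by
      refine (ih.prod ih).of_rel (fun X T ↦ ∃ b : BinaryBicone T.1 T.2,
        Nonempty b.IsBilimit ∧ Nonempty (X ≅ b.pt)) ?_ ?_
      · rintro X ⟨Y, Z, b, hb, e, hY, hZ⟩
        exact ⟨(Y, Z), ⟨hY, hZ⟩, b, hb, e⟩
      · rintro X X' T T' ⟨b, ⟨hb⟩, ⟨e⟩⟩ ⟨b', ⟨hb'⟩, ⟨e'⟩⟩ ⟨f⟩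
        exact ⟨e ≪≫ hb.isLimit.conePointsIsoOfNatIso hb'.isLimit
          (mapPairIso ((CategoryTheory.Prod.fst C C).mapIso f)
            ((CategoryTheory.Prod.snd C C).mapIso f)) ≪≫ e'.symm⟩
    refine ((hz.or hC).or hsum).mono fun X hX ↦ ?_
    by_cases hX₀ : IsZero X
    · exact Or.inl (Or.inl hX₀)
    by_cases hX₁ : IsIndecomposable X
    · exact Or.inl (Or.inr hX₁)
    refine Or.inr ?_
    obtain ⟨Y, Z, b, hb', ⟨e⟩, hY, hZ⟩ : ∃ (Y Z : C) (b : BinaryBicone Y Z),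
        Nonempty b.IsBilimit ∧ Nonempty (X ≅ b.pt) ∧ ¬ IsZero Y ∧ ¬ IsZero Z := by
      by_contra! h
      exact hX₁ ⟨hX₀, fun Y Z b hb hX ↦ or_iff_not_imp_left.2 (h Y Z b hb hX)⟩
    have h₁ := hb Y Z b
    have h₂ := mt (h₀ Y) hY
    have h₃ := mt (h₀ Z) hZ
    have h₄ := hiso _ _ e
    exact ⟨Y, Z, b, hb', ⟨e⟩, by omega, by omega⟩

end Finiteness

/-! ### Finite representation type bounds perfect complexes -/

section

variable {k : Type u} [Field k] {A : Type v} [Ring A] [Algebra k A] [FiniteDimensional k A]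
  [IsNoetherianRing A]

lemma dim_add_dim_le {M N : FGModuleCat.{v} A} (b : BinaryBicone M N) :
    dim k M + dim k N ≤ dim k b.pt := by
  have h₁ := finite_restrict (k := k) M
  have h₂ := finite_restrict (k := k) N
  have h₃ := finite_restrict (k := k) b.pt
  have hf (x : M) : b.fst.hom.hom (b.inl.hom.hom x) = x :=
    congr($(congr(($(b.inl_fst)).hom.hom)) x)
  have hs (x : M) : b.snd.hom.hom (b.inl.hom.hom x) = 0 :=
    congr($(congr(($(b.inl_snd)).hom.hom)) x)
  have hf' (x : N) : b.fst.hom.hom (b.inr.hom.hom x) = 0 :=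
    congr($(congr(($(b.inr_fst)).hom.hom)) x)
  have hs' (x : N) : b.snd.hom.hom (b.inr.hom.hom x) = x :=
    congr($(congr(($(b.inr_snd)).hom.hom)) x)
  refine Module.finrank_prod.symm.trans_le (LinearMap.finrank_le_finrank_of_injective
    (f := (restrictMap k b.inl).coprod (restrictMap k b.inr))
    (Function.LeftInverse.injective (g := (restrictMap k b.fst).prod (restrictMap k b.snd)) ?_))
  rintro ⟨x : M, y : N⟩
  refine Prod.ext ?_ ?_
  · change b.fst.hom.hom (b.inl.hom.hom x + b.inr.hom.hom y) = x
    rw [map_add, hf, hf', add_zero]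
  · change b.snd.hom.hom (b.inl.hom.hom x + b.inr.hom.hom y) = y
    rw [map_add, hs, hs', zero_add]

/-- The term in degree `i` of a homotopy minimal complex. -/
abbrev MinimalComplexes.term (A : Type v) [Ring A] (m : ℕ) (i : ℤ) :
    MinimalComplexes A m ⥤ FGModuleCat.{v} A :=
  ObjectProperty.ι _ ⋙ HomologicalComplex.eval _ _ i ⋙ projInclusion A

variable (k) in
/-- The total dimension of a homotopy minimal complex. -/
def MinimalComplexes.size {m : ℕ} (Z : MinimalComplexes A m) : ℕ :=
  ∑ i ∈ Finset.Icc (0 : ℤ) m, dim k ((MinimalComplexes.term A m i).obj Z)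

lemma MinimalComplexes.isZero_of_size_eq_zero {m : ℕ} (Z : MinimalComplexes A m)
    (hZ : Z.size k = 0) : IsZero Z := by
  obtain ⟨-, _, _⟩ := Z.property
  have h (i : ℤ) : IsZero (Z.obj.X i) := by
    by_cases hi : i ∈ Finset.Icc (0 : ℤ) m
    · exact IsZero.of_full_of_faithful_of_isZero (projInclusion A) (Z.obj.X i)
        (dim_eq_zero_iff.1 (Finset.sum_eq_zero_iff.1 hZ i hi))
    · rw [Finset.mem_Icc, not_and_or] at hi
      obtain hi | hi := hi
      · exact Z.obj.isZero_of_isStrictlyGE 0 i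
      · exact Z.obj.isZero_of_isStrictlyLE m i
  refine IsZero.of_full_of_faithful_of_isZero (ObjectProperty.ι _) Z ?_
  rw [IsZero.iff_id_eq_zero]
  ext i : 1
  exact (h i).eq_of_src _ _

variable [HasDerivedCategory.{w} (FGModuleCat.{v} A)]

lemma finiteBoundedPerfect_of_isOfFiniteRepresentationType (m N : ℕ)
    (h : IsOfFiniteRepresentationType (MinimalComplexes A m)) :
    FiniteBoundedPerfect k A 0 m N := by
  have hfin := h.finiteUpToIso_size_le (MinimalComplexes.size k)
    MinimalComplexes.isZero_of_size_eq_zero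
    (fun Y Z b ↦ by
      unfold MinimalComplexes.size
      rw [← Finset.sum_add_distrib]
      exact Finset.sum_le_sum fun i _ ↦
        dim_add_dim_le ((MinimalComplexes.term A m i).mapBinaryBicone b))
    (fun X Y e ↦ Finset.sum_congr rfl fun i _ ↦
      dim_eq_of_iso ((MinimalComplexes.term A m i).mapIso e)) ((m + 1) * N)
  refine hfin.of_rel (fun Y Z ↦ Nonempty (Y ≅ Q.obj ((complexInclusion A).obj Z.obj))) ?_ ?_
  · rintro Y ⟨K, hK, ⟨e⟩⟩
    obtain ⟨K', hK', hrad, ⟨e'⟩⟩ := exists_radical_perfect hK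
    have := hK'.isStrictlyGE
    have := hK'.isStrictlyLE
    refine ⟨⟨liftProj K' hK'.projective, hrad, liftProj_isStrictlyGE _ _ _,
      liftProj_isStrictlyLE _ _ _⟩, ?_, ⟨e ≪≫ e'⟩⟩
    refine (Finset.sum_le_card_nsmul _ _ N fun i _ ↦ hK'.dim_le i).trans ?_
    simp
  · rintro Y Y' Z Z' ⟨e⟩ ⟨e'⟩ ⟨f⟩
    exact ⟨e ≪≫ Q.mapIso ((complexInclusion A).mapIso ((ObjectProperty.ι _).mapIso f)) ≪≫ e'.symm⟩

/-- Shifting is an equivalence, so only the width of the interval matters, and smaller intervals are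
covered by larger ones. -/
lemma FiniteBoundedPerfect.of_shift {p q p' q' : ℤ} {N : ℕ} (h : FiniteBoundedPerfect k A p' q' N)
    (a : ℤ) (hp : a + p' ≤ p) (hq : q ≤ a + q') : FiniteBoundedPerfect k A p q N := by
  refine h.of_rel (fun Y Y' ↦ Nonempty (Y⟦a⟧ ≅ Y')) ?_ ?_
  · rintro Y ⟨K, hK, ⟨e⟩⟩
    exact ⟨Q.obj (K⟦a⟧), ⟨_, (hK.mono hp hq le_rfl).shift a rfl rfl, ⟨Iso.refl _⟩⟩,
      ⟨(shiftFunctor _ a).mapIso e ≪≫ (Q.commShiftIso a).symm.app K⟩⟩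
  · rintro Y Y' Z Z' ⟨e⟩ ⟨e'⟩ ⟨f⟩
    exact ⟨(shiftFunctor (DerivedCategory (FGModuleCat.{v} A)) a).preimageIso
      (e ≪≫ f ≪≫ e'.symm)⟩

end

end DerivedRep

end

theorem mainTheorem7 {k : Type u} [Field k] {A : Type v} [Ring A] [Algebra k A]
    [FiniteDimensional k A] :
    ((∀ m : ℕ, 0 < m →
        DerivedRep.IsOfFiniteRepresentationType (DerivedRep.MinimalComplexes A m)) →
      DerivedRep.IsKbDiscrete k A) ∧
    (DerivedRep.IsKbDiscrete k A ↔ DerivedRep.IsDerivedDiscrete k A) := by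
  have : IsNoetherianRing A := IsNoetherianRing.of_finite k A
  let := HasDerivedCategory.standard (FGModuleCat.{v} A)
  refine ⟨fun h ↦ DerivedRep.isKbDiscrete_of_isDerivedDiscrete
    (DerivedRep.isDerivedDiscrete_of_finiteBoundedPerfect fun p q N ↦ ?_),
    fun h ↦ DerivedRep.isDerivedDiscrete_of_finiteBoundedPerfect
      (DerivedRep.finiteBoundedPerfect_of_isKbDiscrete h),
    DerivedRep.isKbDiscrete_of_isDerivedDiscrete⟩
  -- The extra 1 makes m positive, as the hypothesis requires; shifting by p moves [p, q] into [0,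
  -- m].
  exact (DerivedRep.finiteBoundedPerfect_of_isOfFiniteRepresentationType ((q - p).toNat + 1) N
    (h _ (Nat.succ_pos _))).of_shift p (by lia) (by lia)
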